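/- For a group $H$, let $H^{\varphi}$ be an isomorphic copy of $H$ (disjoint from $H$) via $h \mapsto h^{\varphi}$, write $x^y = y^{-1}xy$ and $[x,y] = x^{-1}y^{-1}xy$, and let $$\nu(H) = \left\langle H \cup H^{\varphi} \;\middle|\; [g,h^{\varphi}]^{k} = [g^{k},(h^{k})^{\varphi}] = [g,h^{\varphi}]^{k^{\varphi}} \ \text{ for all } g,h,k \in H \right\rangle,$$ that is, the quotient of the free product of $H$ and $H^{\varphi}$ by these relations. A prime denotes the derived (commutator) subgroup. A group $G$ is called a $\nu$-group if there is a group $H$ with $H'$ finitely generated such that $G \cong \nu(H)'$. A group is called central-by-finite if it has a central subgroup of finite index. Corollary C. Let $G$ be a $\nu$-group. If $G'$ is finite, then $G$ is central-by-finite. (So $\nu$-groups satisfy the converse of Schur's theorem.) -/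

import Mathlib

universe u v

namespace NuGroup

/-- Right conjugation `x ^ y = y⁻¹ x y`. -/
def rightConj {A : Type*} [Group A] (x y : A) : A := y⁻¹ * x * y

/-- The commutator `[x, y] = x⁻¹ y⁻¹ x y`. -/
def rightComm {A : Type*} [Group A] (x y : A) : A := x⁻¹ * y⁻¹ * x * y

/-- The relators of `ν(H)` in the free product `H ∗ H^φ` (`H^φ` is the second copy of `H`):
they say `[g, h^φ]^k = [g^k, (h^k)^φ]` and `[g, h^φ]^(k^φ) = [g^k, (h^k)^φ]`
for all `g, h, k` in `H`. The relations inside `H` and inside `H^φ` hold already in the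
free product. -/
def relators (H : Type u) [Group H] : Set (Monoid.Coprod H H) :=
  {w | ∃ g h k : H,
    w = rightConj (rightComm (Monoid.Coprod.inl g) (Monoid.Coprod.inr h)) (Monoid.Coprod.inl k) *
        (rightComm (Monoid.Coprod.inl (rightConj g k)) (Monoid.Coprod.inr (rightConj h k)))⁻¹ ∨
    w = rightConj (rightComm (Monoid.Coprod.inl g) (Monoid.Coprod.inr h)) (Monoid.Coprod.inr k) *
        (rightComm (Monoid.Coprod.inl (rightConj g k)) (Monoid.Coprod.inr (rightConj h k)))⁻¹}

/-- The group `ν(H) = ⟨H ∪ H^φ | [g, h^φ]^k = [g^k, (h^k)^φ] = [g, h^φ]^(k^φ)⟩`. -/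
abbrev Nu (H : Type u) [Group H] : Type u :=
  Monoid.Coprod H H ⧸ Subgroup.normalClosure (relators H)

/-- `G` is a `ν`-group: `G ≅ ν(H)'` for some group `H` with `H'` finitely generated. -/
def IsNuGroup (G : Type u) [Group G] : Prop :=
  ∃ (H : Type v) (_ : Group H),
    (commutator H).FG ∧ Nonempty (G ≃* commutator (Nu H))

/-- `G` is central-by-finite: it has a central subgroup of finite index. -/
def IsCentralByFinite (G : Type u) [Group G] : Prop :=
  ∃ Z : Subgroup G, Z ≤ Subgroup.center G ∧ Z.FiniteIndex

end NuGroup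

/-! The kernel of `ν(H) → (H × H) × H`, given by `proj` and `fold`, is central (`ker_le_center`): it
lies in `[H, H^φ]`, on which conjugation factors through `fold`, and its elements commute with
`H^φ`. On derived subgroups the map is onto `(H' × H') × H'`, so `G` is a central extension of a
finitely generated group. If `G'` is finite, all centralizers have finite index, and those of lifts
of the generators meet inside the centre. -/

namespace NuGroup

open scoped commutatorElement

section Calculus

variable {A B : Type*} [Group A] [Group B]

theorem rightConj_mul_left (x y z : A) :
    rightConj (x * y) z = rightConj x z * rightConj y z := by
  simp only [rightConj]; group

theorem rightConj_inv_left (x z : A) : rightConj x⁻¹ z = (rightConj x z)⁻¹ := by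
  simp only [rightConj]; group

theorem rightConj_one_left (z : A) : rightConj 1 z = 1 := by
  simp [rightConj]

theorem rightConj_mul_right (x y z : A) :
    rightConj x (y * z) = rightConj (rightConj x y) z := by
  simp only [rightConj]; group

theorem rightConj_rightConj_inv (x y : A) : rightConj (rightConj x y⁻¹) y = x := by
  simp only [rightConj]; group

theorem rightComm_mul_left (x y z : A) :
    rightComm (x * y) z = rightConj (rightComm x z) y * rightComm y z := by
  simp only [rightComm, rightConj]; group

theorem rightComm_inv_left (x z : A) :
    rightComm x⁻¹ z = (rightConj (rightComm x z) x⁻¹)⁻¹ := by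
  simp only [rightComm, rightConj]; group

theorem rightComm_one_left (z : A) : rightComm 1 z = 1 := by
  simp [rightComm]

theorem rightComm_eq_inv_mul_rightConj (x y : A) : rightComm x y = x⁻¹ * rightConj x y := by
  simp only [rightComm, rightConj]; group

theorem rightConj_rightComm (x y z : A) :
    rightConj (rightComm x y) z = rightComm (rightConj x z) (rightConj y z) := by
  simp only [rightComm, rightConj]; group

theorem map_rightConj (f : A →* B) (x y : A) : f (rightConj x y) = rightConj (f x) (f y) := by
  simp [rightConj]

theorem map_rightComm (f : A →* B) (x y : A) : f (rightComm x y) = rightComm (f x) (f y) := by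
  simp [rightComm]

theorem commute_of_rightConj_eq {x y : A} (h : rightConj x y = x) : y * x = x * y := by
  have := congrArg (y * ·) h
  simp only [rightConj] at this
  rw [← this]; group

theorem commutatorElement_eq_rightComm (x y : A) : ⁅x, y⁆ = rightComm x⁻¹ y⁻¹ := by
  simp [commutatorElement_def, rightComm]

theorem rightComm_mem_commutator (x y : A) : rightComm x y ∈ commutator A := by
  have := Subgroup.commutator_mem_commutator (Subgroup.mem_top x⁻¹) (Subgroup.mem_top y⁻¹)
  rwa [commutatorElement_eq_rightComm, inv_inv, inv_inv] at this

theorem map_mem_commutator (f : A →* B) {x : A} (hx : x ∈ commutator A) :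
    f x ∈ commutator B := by
  have h : (commutator A).map f ≤ commutator B := by
    rw [commutator_def, Subgroup.map_commutator, commutator_def]
    exact Subgroup.commutator_mono le_top le_top
  exact h ⟨x, hx, rfl⟩

/-- The map between derived subgroups induced by a homomorphism. -/
def mapCommutator (f : A →* B) : commutator A →* commutator B :=
  (f.comp (commutator A).subtype).codRestrict _ fun x => map_mem_commutator f x.2

end Calculus

/-! ### Structure of `ν(H)` and its central kernel -/

namespace Nu

variable {H : Type*} [Group H]

/-- The canonical map `H → ν(H)`. -/
def left : H →* Nu H := (QuotientGroup.mk' _).comp Monoid.Coprod.inl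

/-- The canonical map `H^φ → ν(H)`. -/
def right : H →* Nu H := (QuotientGroup.mk' _).comp Monoid.Coprod.inr

theorem rightConj_rightComm_left (g h k : H) :
    rightConj (rightComm (left g) (right h)) (left k) =
      rightComm (left (rightConj g k)) (right (rightConj h k)) := by
  have := (QuotientGroup.eq_one_iff (N := Subgroup.normalClosure (relators H)) _).2
    (Subgroup.subset_normalClosure ⟨g, h, k, Or.inl rfl⟩)
  exact mul_inv_eq_one.1 this

theorem rightConj_rightComm_right (g h k : H) :
    rightConj (rightComm (left g) (right h)) (right k) =
      rightComm (left (rightConj g k)) (right (rightConj h k)) := by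
  have := (QuotientGroup.eq_one_iff (N := Subgroup.normalClosure (relators H)) _).2
    (Subgroup.subset_normalClosure ⟨g, h, k, Or.inr rfl⟩)
  exact mul_inv_eq_one.1 this

@[elab_as_elim]
theorem induction_on {p : Nu H → Prop} (x : Nu H) (hl : ∀ h, p (left h))
    (hr : ∀ h, p (right h)) (hm : ∀ x y, p x → p y → p (x * y)) : p x := by
  induction x using QuotientGroup.induction_on with
  | H z =>
    induction z using Monoid.Coprod.induction_on with
    | inl h => exact hl h
    | inr h => exact hr h
    | mul x y hx hy => exact hm _ _ hx hy

/-- The homomorphism out of `ν(H)` given by two homomorphisms that respect the relations. -/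
def lift {A : Type*} [Group A] (α β : H →* A)
    (h₁ : ∀ g h k, rightConj (rightComm (α g) (β h)) (α k) =
      rightComm (α (rightConj g k)) (β (rightConj h k)))
    (h₂ : ∀ g h k, rightConj (rightComm (α g) (β h)) (β k) =
      rightComm (α (rightConj g k)) (β (rightConj h k))) : Nu H →* A :=
  QuotientGroup.lift _ (Monoid.Coprod.lift α β) <| by
    refine Subgroup.normalClosure_le_normal (N := (Monoid.Coprod.lift α β).ker) ?_
    rintro w ⟨g, h, k, rfl | rfl⟩
    · simpa [MonoidHom.mem_ker, map_rightConj, map_rightComm, mul_inv_eq_one] using h₁ g h k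
    · simpa [MonoidHom.mem_ker, map_rightConj, map_rightComm, mul_inv_eq_one] using h₂ g h k

/-- The retraction `ν(H) → H` that identifies the two copies of `H`. -/
def fold : Nu H →* H :=
  lift (MonoidHom.id H) (MonoidHom.id H) (fun _ _ _ => rightConj_rightComm _ _ _)
    (fun _ _ _ => rightConj_rightComm _ _ _)

/-- The projection `ν(H) → H × H`. -/
def proj : Nu H →* H × H :=
  lift (MonoidHom.inl H H) (MonoidHom.inr H H)
    (fun g h k => by ext <;> simp [rightConj, rightComm, mul_assoc])
    (fun g h k => by ext <;> simp [rightConj, rightComm, mul_assoc])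

@[simp] theorem fold_left (h : H) : fold (left h) = h := rfl
@[simp] theorem fold_right (h : H) : fold (right h) = h := rfl
@[simp] theorem proj_left (h : H) : proj (left h) = (h, 1) := rfl
@[simp] theorem proj_right (h : H) : proj (right h) = (1, h) := rfl

/-- The subgroup `[H, H^φ]` of `ν(H)`. -/
def tensor (H : Type*) [Group H] : Subgroup (Nu H) :=
  Subgroup.closure {x | ∃ g h : H, x = rightComm (left g) (right h)}

theorem rightComm_mem_tensor (g h : H) : rightComm (left g) (right h) ∈ tensor H :=
  Subgroup.subset_closure ⟨g, h, rfl⟩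

theorem rightConj_left_tensor {s : Nu H} (hs : s ∈ tensor H) (k : H) :
    rightConj s (left k) ∈ tensor H ∧ rightConj s (right k) = rightConj s (left k) := by
  induction hs using Subgroup.closure_induction with
  | mem x hx =>
    obtain ⟨g, h, rfl⟩ := hx
    rw [rightConj_rightComm_left, rightConj_rightComm_right]
    exact ⟨rightComm_mem_tensor _ _, rfl⟩
  | one => simp [rightConj_one_left, one_mem]
  | mul x y _ _ hx hy =>
    simp only [rightConj_mul_left, hx.2, hy.2, and_true]
    exact mul_mem hx.1 hy.1
  | inv x _ hx =>
    simp only [rightConj_inv_left, hx.2, and_true]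
    exact inv_mem hx.1

/-- `ν(H)` acts on `[H, H^φ]` by conjugation through its retraction to `H`. -/
theorem rightConj_tensor (x : Nu H) : ∀ s ∈ tensor H,
    rightConj s x ∈ tensor H ∧ rightConj s x = rightConj s (left (fold x)) := by
  induction x using induction_on with
  | hl h => exact fun s hs => ⟨(rightConj_left_tensor hs h).1, rfl⟩
  | hr h =>
    intro s hs
    have := rightConj_left_tensor hs h
    exact ⟨this.2 ▸ this.1, this.2⟩
  | hm x y hx hy =>
    intro s hs
    have h₁ := hx s hs
    have h₂ := hy _ h₁.1
    rw [rightConj_mul_right]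
    exact ⟨h₂.1, by rw [h₂.2, h₁.2, map_mul, map_mul, rightConj_mul_right]⟩

theorem rightConj_tensor_congr {x y s : Nu H} (hs : s ∈ tensor H) (h : fold x = fold y) :
    rightConj s x = rightConj s y := by
  rw [(rightConj_tensor x s hs).2, (rightConj_tensor y s hs).2, h]

/-- `[[g, h^φ], k^φ] = [[g, h], k^φ]`. -/
theorem rightComm_rightComm_right (g h k : H) :
    rightComm (rightComm (left g) (right h)) (right k) =
      rightComm (rightComm (left g) (left h)) (right k) := by
  have key : rightComm (rightConj (left g) (right h)) (right k) =
      rightComm (rightConj (left g) (left h)) (right k) := by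
    -- Twisting `k` by `h⁻¹` makes the second entry exactly `k^φ` after conjugation by `h^φ`.
    have h₁ := rightConj_rightComm_right g (rightConj k h⁻¹) h
    rw [rightConj_rightConj_inv, rightConj_rightComm, ← map_rightConj right,
      rightConj_rightConj_inv, map_rightConj left] at h₁
    exact h₁
  rw [rightComm_eq_inv_mul_rightConj (left g) (right h),
    rightComm_eq_inv_mul_rightConj (left g) (left h), rightComm_mul_left, rightComm_mul_left, key]
  congr 1
  rw [← map_inv]
  exact rightConj_tensor_congr (rightComm_mem_tensor _ _) (by simp [map_rightConj])

/-- Both sides expand by the same product rule, and the conjugations that appear depend only on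
`fold`. Hence elements of `[H, H^φ]` with trivial `fold` commute with `H^φ`. -/
theorem rightComm_tensor_right {t : Nu H} (ht : t ∈ tensor H) (k : H) :
    rightComm t (right k) = rightComm (left (fold t)) (right k) := by
  induction ht using Subgroup.closure_induction with
  | mem x hx =>
    obtain ⟨g, h, rfl⟩ := hx
    rw [rightComm_rightComm_right, map_rightComm, map_rightComm, fold_left, fold_right]
  | one => simp
  | mul x y _ _ hx hy =>
    rw [map_mul, map_mul, rightComm_mul_left, rightComm_mul_left, hx, hy,
      rightConj_tensor_congr (rightComm_mem_tensor _ _) (fold_left (fold y)).symm]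
  | inv x _ hx =>
    rw [map_inv, map_inv, rightComm_inv_left, rightComm_inv_left, hx, ← map_inv, ← map_inv,
      rightConj_tensor_congr (rightComm_mem_tensor _ _) (fold_left (fold x⁻¹)).symm]

theorem exists_left_mul_right_mul_tensor (x : Nu H) :
    ∃ a b : H, ∃ t ∈ tensor H, x = left a * right b * t := by
  induction x using induction_on with
  | hl h => exact ⟨h, 1, 1, one_mem _, by simp⟩
  | hr h => exact ⟨1, h, 1, one_mem _, by simp⟩
  | hm x y hx hy =>
    obtain ⟨a, b, t, ht, rfl⟩ := hx
    obtain ⟨c, d, u, hu, rfl⟩ := hy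
    refine ⟨a * c, b * d, rightConj (rightComm (left c) (right b))⁻¹ (right d) *
      rightConj t (left c * right d) * u, mul_mem (mul_mem ?_ ?_) hu, ?_⟩
    · exact (rightConj_tensor _ _ (inv_mem (rightComm_mem_tensor _ _))).1
    · exact (rightConj_tensor _ _ ht).1
    · simp only [map_mul, rightConj, rightComm]; group

/-- The kernel of `ν(H) → (H × H) × H` is central. -/
theorem ker_le_center : (proj.prod fold : Nu H →* (H × H) × H).ker ≤ Subgroup.center (Nu H) := by
  intro x hx
  have hx' : proj x = 1 ∧ fold x = 1 := by simpa [MonoidHom.mem_ker] using hx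
  obtain ⟨hp, hf⟩ := hx'
  have hpt : ∀ t ∈ tensor H, proj t = 1 := by
    intro t ht
    induction ht using Subgroup.closure_induction with
    | mem x hx => obtain ⟨g, h, rfl⟩ := hx; simp [rightComm]
    | one => simp
    | mul x y _ _ hx hy => simp [hx, hy]
    | inv x _ hx => simp [hx]
  have ht : x ∈ tensor H := by
    obtain ⟨a, b, t, ht, rfl⟩ := exists_left_mul_right_mul_tensor x
    have : a = 1 ∧ b = 1 := by simpa [hpt t ht] using hp
    simpa [this.1, this.2] using ht
  have hr (k : H) : rightConj x (right k) = x := by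
    have := rightComm_tensor_right ht k
    rw [hf, map_one, rightComm_one_left, rightComm_eq_inv_mul_rightConj] at this
    exact (inv_mul_eq_one.1 this).symm
  rw [Subgroup.mem_center_iff]
  intro y
  refine commute_of_rightConj_eq ?_
  -- Conjugation by `y` agrees with conjugation by `(fold y)^φ`.
  rw [rightConj_tensor_congr ht (fold_right (fold y)).symm, hr]

/-- The map `ν(H)' → (H' × H') × H'`. -/
def commutatorMap (H : Type*) [Group H] :
    commutator (Nu H) →* (commutator H × commutator H) × commutator H :=
  ((mapCommutator ((MonoidHom.fst H H).comp proj)).prod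
    (mapCommutator ((MonoidHom.snd H H).comp proj))).prod (mapCommutator fold)

theorem commutatorMap_ker_le_center :
    (commutatorMap H).ker ≤ Subgroup.center (commutator (Nu H)) := by
  intro x hx
  have hx : commutatorMap H x = 1 := hx
  have h : x.1 ∈ Subgroup.center (Nu H) := ker_le_center <| by
    have h₁ := congrArg (fun z => (z.1.1 : H)) hx
    have h₂ := congrArg (fun z => (z.1.2 : H)) hx
    have h₃ := congrArg (fun z => (z.2 : H)) hx
    exact Prod.ext (Prod.ext h₁ h₂) h₃
  rw [Subgroup.mem_center_iff] at h ⊢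
  exact fun y => Subtype.ext (h y)

/-- `[g, h^φ]` dies in `H × H` but folds to `[g, h]`, so the `fold` coordinate can be adjusted
independently. -/
theorem exists_fold_eq {c : H} (hc : c ∈ commutator H) :
    ∃ t ∈ commutator (Nu H), proj t = 1 ∧ fold t = c := by
  rw [commutator_eq_closure] at hc
  induction hc using Subgroup.closure_induction with
  | mem x hx =>
    obtain ⟨g, h, rfl⟩ := hx
    refine ⟨rightComm (left g⁻¹) (right h⁻¹), rightComm_mem_commutator _ _, ?_, ?_⟩
    · simp [rightComm]
    · rw [map_rightComm, fold_left, fold_right, commutatorElement_eq_rightComm]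
  | one => exact ⟨1, one_mem _, map_one _, map_one _⟩
  | mul x y _ _ hx hy =>
    obtain ⟨t, ht, hp, rfl⟩ := hx
    obtain ⟨u, hu, hq, rfl⟩ := hy
    exact ⟨t * u, mul_mem ht hu, by simp [hp, hq], map_mul _ _ _⟩
  | inv x _ hx =>
    obtain ⟨t, ht, hp, rfl⟩ := hx
    exact ⟨t⁻¹, inv_mem ht, by simp [hp], map_inv _ _⟩

theorem commutatorMap_surjective : Function.Surjective (commutatorMap H) := by
  rintro ⟨⟨a, b⟩, c⟩
  -- `left a * right b` already folds to `a * b`; `t` supplies the rest.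
  obtain ⟨t, ht, hp, hf⟩ := exists_fold_eq ((a * b)⁻¹ * c).2
  refine ⟨⟨left a.1 * right b.1 * t, mul_mem (mul_mem (map_mem_commutator _ a.2)
    (map_mem_commutator _ b.2)) ht⟩, ?_⟩
  have hp' : proj (left a.1 * right b.1 * t) = (a.1, b.1) := by simp [hp]
  refine Prod.ext (Prod.ext (Subtype.ext ?_) (Subtype.ext ?_)) (Subtype.ext ?_)
  · exact congrArg Prod.fst hp'
  · exact congrArg Prod.snd hp'
  · change fold (left a.1 * right b.1 * t) = c.1
    simp [hf, mul_assoc]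

end Nu

/-! ### Central extensions of finitely generated groups -/

/-- A group with finite derived subgroup that is a central extension of a finitely generated
group has centre of finite index. -/
theorem finiteIndex_center_of_ker_le_center {G Q : Type*} [Group G] [Group Q]
    [Finite (commutator G)] [Group.FG Q] (f : G →* Q) (hf : Function.Surjective f)
    (hker : f.ker ≤ Subgroup.center G) : (Subgroup.center G).FiniteIndex := by
  obtain ⟨S, hS⟩ := Group.fg_def.1 (inferInstance : Group.FG Q)
  choose g hg using hf
  have hfin (x : G) : (Subgroup.centralizer {x}).FiniteIndex := by
    have : Finite (commutatorSet G) :=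
      Set.Finite.subset (Set.toFinite (commutator G : Set G)) (by
        rw [commutator_eq_closure]; exact Subgroup.subset_closure)
    have := Finite.of_injective (β := commutatorSet G) _ (Subgroup.quotientCentralizerEmbedding x).injective
    exact Subgroup.finiteIndex_of_finite_quotient
  have hinf : (⨅ s ∈ S, Subgroup.centralizer {g s}).FiniteIndex :=
    Subgroup.finiteIndex_iInf' _ fun s _ => hfin (g s)
  suffices h : (⨅ s ∈ S, Subgroup.centralizer {g s}) ≤
      Subgroup.center G from Subgroup.finiteIndex_of_le h
  intro z hz
  simp only [Subgroup.mem_iInf] at hz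
  rw [Subgroup.mem_center_iff]
  -- So every `y` is an element of the centralizer of `z` times an element of the central kernel.
  have hle : (⊤ : Subgroup Q) ≤ (Subgroup.centralizer {z}).map f := by
    rw [← hS, Subgroup.closure_le]
    intro s hs
    refine ⟨g s, ?_, hg s⟩
    exact Subgroup.mem_centralizer_singleton_iff.2
      (Subgroup.mem_centralizer_singleton_iff.1 (hz s hs)).symm
  intro y
  obtain ⟨w, hw, hwy⟩ := hle (Subgroup.mem_top (f y))
  have hc := Subgroup.mem_center_iff.1 (hker (show w⁻¹ * y ∈ f.ker by
    simp [MonoidHom.mem_ker, hwy])) z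
  have hw : w * z = z * w := Subgroup.mem_centralizer_singleton_iff.1 hw
  calc y * z = w * (w⁻¹ * y * z) := by group
    _ = w * z * (w⁻¹ * y) := by rw [← hc, mul_assoc]
    _ = z * y := by rw [hw]; group

end NuGroup

theorem corollaryC (G : Type u) [Group G] (hG : NuGroup.IsNuGroup.{u, v} G)
    (hfin : Finite (commutator G)) : NuGroup.IsCentralByFinite G := by
  obtain ⟨H, _, hH, ⟨e⟩⟩ := hG
  have : Group.FG (commutator H) := (Group.fg_iff_subgroup_fg _).2 hH
  refine ⟨_, le_rfl, NuGroup.finiteIndex_center_of_ker_le_center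
    ((NuGroup.Nu.commutatorMap H).comp e.toMonoidHom)
    (NuGroup.Nu.commutatorMap_surjective.comp e.surjective) ?_⟩
  intro x hx
  have h := Subgroup.mem_center_iff.1
    (NuGroup.Nu.commutatorMap_ker_le_center (show e x ∈ (NuGroup.Nu.commutatorMap H).ker from hx))
  exact Subgroup.mem_center_iff.2 fun y => e.injective (by simpa using h (e y))
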